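/- A matroid $M=(V,\mathcal I)$ or a graph $G=(V,E)$ is identified with a set system on $V$: the family $\mathcal I$ of independent sets of $M$, respectively the family $\mathcal J$ of sets of pairwise non-adjacent vertices of $G$. Put $G\cap M=(V,\mathcal I\cap\mathcal J)$. A coloring of a set system on $V$ assigns one color to each element of $V$ so that every color class belongs to the system, and $\chi$ denotes the minimum number of colors of a coloring. **Theorem.** There is a polynomial-time algorithm which, given a finite simple graph $G$ on $V$ with maximum degree at most $\Delta$ and an arbitrary loopless matroid $M$ with ground set $V$, produces a coloring of $G\cap M$ with at most $\Delta+\chi(M)+1$ colors; that is, every color class is an independent set of $G$ and an independent set of $M$. Here $V=\{0,\dots,n-1\}$, the graph is given by its adjacency matrix, and the matroid is given by an independence oracle, which answers whether a given subset of $V$ is independent in $M$. The algorithm is one program, the same for all inputs, for a random access machine whose arithmetic operations are addition and truncated subtraction at unit cost; a query with a characteristic vector of length $m$ costs $m+1$ steps. The number of steps is bounded by a fixed polynomial in $n$. The algorithm is given neither $\Delta$ nor $\chi(M)$. -/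

import Mathlib

/-! ### Set systems and their colorings -/

/-- `c` colors the elements of `V` with the `k` colors of `Fin k` so that every color class belongs
to the set system `F`. -/
def IsColoring {V : Type*} (F : Set (Set V)) {k : ℕ} (c : V → Fin k) : Prop :=
  ∀ i : Fin k, {v | c v = i} ∈ F

/-- The least number of colors of a coloring of the set system `F`
(a natural number; meaningful when some coloring exists). -/
noncomputable def chromaticNum {V : Type*} (F : Set (Set V)) : ℕ :=
  sInf {k | ∃ c : V → Fin k, IsColoring F c}

/-- The set system of the independent sets of a matroid. -/
def matroidSystem {V : Type*} (M : Matroid V) : Set (Set V) :=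
  {S | M.Indep S}

/-- The set system of the independent (pairwise non-adjacent) vertex sets of a graph. -/
def graphSystem {V : Type*} (G : SimpleGraph V) : Set (Set V) :=
  {S | G.IsIndepSet S}

/-! ### Random access programs with a set oracle

The memory consists of two-dimensional arrays of natural numbers; `s a i j` is the content of
cell `(i, j)` of the array with name `a`. A program is a finite syntactic object, it names finitely
many arrays, and its cell indices are computed at run time. The only arithmetic operations are
addition and truncated subtraction, so in `t` steps no number grows beyond `O(t)` more bits than
those of the input, and unit cost is polynomially equivalent to Turing machine time. -/

/-- Memory states. -/
abbrev Store : Type := ℕ → ℕ → ℕ → ℕ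

/-- Overwrite cell `(i, j)` of array `a` by `x`. -/
def Store.write (s : Store) (a i j x : ℕ) : Store :=
  fun a' i' j' => if a' = a ∧ i' = i ∧ j' = j then x else s a' i' j'

/-- Arithmetic expressions. -/
inductive Expr : Type
  | const (x : ℕ)
  | cell (a : ℕ) (i j : Expr)
  | add (e f : Expr)
  | sub (e f : Expr)

/-- The value of an expression in a memory state (subtraction is truncated at zero). -/
def Expr.val (s : Store) : Expr → ℕ
  | .const x => x
  | .cell a i j => s a (i.val s) (j.val s)
  | .add e f => e.val s + f.val s
  | .sub e f => e.val s - f.val s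

/-- Programs. -/
inductive Prog : Type
  | skip
  /-- Store the value of `e` in cell `(i, j)` of array `a`. -/
  | assign (a : ℕ) (i j e : Expr)
  /-- Ask the oracle about the set of all `j < m` for which cell `(r, j)` of array `a` is nonzero,
  and store the answer, `1` for yes and `0` for no, in cell `(0, 0)` of array `b`. -/
  | query (b a : ℕ) (r m : Expr)
  | seq (P Q : Prog)
  /-- Run `P` if `e` is nonzero, else `Q`. -/
  | ite (e : Expr) (P Q : Prog)
  /-- Run `P` again and again as long as `e` is nonzero. -/
  | loop (e : Expr) (P : Prog)

/-- The set that a query asks about. -/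
def querySet (s : Store) (a r m : ℕ) : Finset ℕ :=
  (Finset.range m).filter fun j => s a r j ≠ 0

open Classical in
/-- `Exec O P s s' t`: with the oracle `O`, the program `P` started in memory state `s` halts in
memory state `s'` after `t` steps. Every assignment, every `skip` and every evaluation of a test
is one step (the sizes of the expressions in `P` are constants of `P`), and a query about a
characteristic vector of length `m` takes `m + 1` steps. -/
inductive Exec (O : Finset ℕ → Prop) : Prog → Store → Store → ℕ → Prop
  | skip (s : Store) : Exec O .skip s s 1
  | assign (s : Store) (a : ℕ) (i j e : Expr) :
      Exec O (.assign a i j e) s (s.write a (i.val s) (j.val s) (e.val s)) 1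
  | query (s : Store) (b a : ℕ) (r m : Expr) :
      Exec O (.query b a r m) s
        (s.write b 0 0 (if O (querySet s a (r.val s) (m.val s)) then 1 else 0)) (m.val s + 1)
  | seq {P Q : Prog} {s s' s'' : Store} {t t' : ℕ} :
      Exec O P s s' t → Exec O Q s' s'' t' → Exec O (.seq P Q) s s'' (t + t')
  | ite_true {e : Expr} {P Q : Prog} {s s' : Store} {t : ℕ} :
      e.val s ≠ 0 → Exec O P s s' t → Exec O (.ite e P Q) s s' (t + 1)
  | ite_false {e : Expr} {P Q : Prog} {s s' : Store} {t : ℕ} :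
      e.val s = 0 → Exec O Q s s' t → Exec O (.ite e P Q) s s' (t + 1)
  | loop_done {e : Expr} {P : Prog} {s : Store} :
      e.val s = 0 → Exec O (.loop e P) s s 1
  | loop_step {e : Expr} {P : Prog} {s s' s'' : Store} {t t' : ℕ} :
      e.val s ≠ 0 → Exec O P s s' t → Exec O (.loop e P) s' s'' t' →
        Exec O (.loop e P) s s'' (t + t' + 1)

/-- Programs are deterministic: the final memory state and the number of steps are determined by
the program, the oracle and the initial memory state. -/
theorem Exec.deterministic {O : Finset ℕ → Prop} {P : Prog} {s s₁ s₂ : Store} {t₁ t₂ : ℕ}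
    (h₁ : Exec O P s s₁ t₁) (h₂ : Exec O P s s₂ t₂) : s₁ = s₂ ∧ t₁ = t₂ := by
  induction h₁ generalizing s₂ t₂ with
  | skip s => cases h₂; exact ⟨rfl, rfl⟩
  | assign s a i j e => cases h₂; exact ⟨rfl, rfl⟩
  | query s b a r m => cases h₂; exact ⟨rfl, rfl⟩
  | seq _ _ ih ih' =>
    cases h₂ with
    | seq k k' =>
      obtain ⟨rfl, rfl⟩ := ih k
      obtain ⟨rfl, rfl⟩ := ih' k'
      exact ⟨rfl, rfl⟩
  | ite_true h _ ih =>
    cases h₂ with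
    | ite_true _ k => obtain ⟨rfl, rfl⟩ := ih k; exact ⟨rfl, rfl⟩
    | ite_false h' _ => exact absurd h' h
  | ite_false h _ ih =>
    cases h₂ with
    | ite_true h' _ => exact absurd h h'
    | ite_false _ k => obtain ⟨rfl, rfl⟩ := ih k; exact ⟨rfl, rfl⟩
  | loop_done h =>
    cases h₂ with
    | loop_done _ => exact ⟨rfl, rfl⟩
    | loop_step h' _ _ => exact absurd h h'
  | loop_step h _ _ ih ih' =>
    cases h₂ with
    | loop_done h' => exact absurd h' h
    | loop_step _ k k' =>
      obtain ⟨rfl, rfl⟩ := ih k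
      obtain ⟨rfl, rfl⟩ := ih' k'
      exact ⟨rfl, rfl⟩

/-! ### Input and output -/

/-- The independence oracle of a matroid whose elements are numbered `0, …, n - 1`. -/
def indepOracle {n : ℕ} (M : Matroid (Fin n)) : Finset ℕ → Prop :=
  fun S => M.Indep {v : Fin n | (v : ℕ) ∈ S}

/-- The initial memory state for a graph with vertices `0, …, n - 1`: cell `(0, 0)` of array `0`
holds `n`, array `1` holds the adjacency matrix, and all other cells hold `0`. -/
def graphInput {n : ℕ} (G : SimpleGraph (Fin n)) [DecidableRel G.Adj] : Store :=
  fun a i j =>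
    if a = 0 ∧ i = 0 ∧ j = 0 then n
    else if a = 1 then
      if h : i < n ∧ j < n then (if G.Adj ⟨i, h.1⟩ ⟨j, h.2⟩ then 1 else 0) else 0
    else 0

/-- The output of a run: the color of vertex `v` is in cell `(0, v)` of array `2`. -/
def Outputs {n k : ℕ} (s : Store) (c : Fin n → Fin k) : Prop :=
  ∀ v : Fin n, s 2 0 v = (c v : ℕ)

/-! The algorithm augments along labels, in the manner of push-relabel. For a fixed number `D` of
colors it keeps disjoint classes, independent in `G` and in `M`, and a label on every element, at
first 1. To color `v`, it considers the classes without a neighbor of `v` and picks an exchange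
evicting an element of least label `l`; a free insertion evicts a dummy of label 0. The label of `v`
is raised to at least `l + 1`, and the evicted element is colored next.

The invariant is `Labelled.spanned`: an element of label above `j` is spanned, in all but at most
`maxDegree` classes, by the members of label at least `j`. For `v` this follows from the minimality
of `l` (`mem_closure_highPart`), since at most `maxDegree` classes are blocked (`card_unblocked`).
It persists because an exchange never shrinks the span of such a high part (`Labelled.exchange`).

Let `D ≥ maxDegree + k + 1` with `k = χ(M)`, and let `V j` be the set of elements of label at least
`j`. Each element of `V (j + 1)` is spanned by the high parts of at least `k + 1` classes. These
parts are disjoint subsets of `V j`, and an independent set `S` spans at most `k * |S|` elements. So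
`(k + 1) * |V (j + 1)| ≤ k * |V j|`, the levels shrink strictly until they are empty, and no label
exceeds `n` (`Labelled.label_le`). If no exchange of label at most `n` is found, then `D` was too
small, and a restart with one more color is safe without knowing `Δ` or `χ(M)`.

Every exchange increases the sum of the labels of the colored elements, which is at most `n * (n +
1)`, and `D` never exceeds `2 * n + 1`. This gives polynomial time. -/

/-! ### Total correctness with a time bound -/

/-- With the oracle `O`, the program `P` started in `s` halts after at most `T` steps in a memory
state with the property `Q`. -/
def Runs (O : Finset ℕ → Prop) (P : Prog) (s : Store) (T : ℕ) (Q : Store → Prop) : Prop :=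
  ∃ s' t, Exec O P s s' t ∧ t ≤ T ∧ Q s'

namespace Runs

variable {O : Finset ℕ → Prop} {P P' : Prog} {s : Store} {T T' : ℕ} {Q R : Store → Prop}

theorem mono (h : Runs O P s T Q) (hT : T ≤ T') (hQ : ∀ s', Q s' → R s') : Runs O P s T' R := by
  obtain ⟨s', t, he, ht, hq⟩ := h
  exact ⟨s', t, he, ht.trans hT, hQ _ hq⟩

theorem assign {a : ℕ} {i j e : Expr} (h : Q (s.write a (i.val s) (j.val s) (e.val s))) :
    Runs O (.assign a i j e) s 1 Q :=
  ⟨_, _, .assign s a i j e, le_rfl, h⟩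

open Classical in
theorem query {b a : ℕ} {r m : Expr}
    (h : Q (s.write b 0 0 (if O (querySet s a (r.val s) (m.val s)) then 1 else 0))) :
    Runs O (.query b a r m) s (m.val s + 1) Q :=
  ⟨_, _, .query s b a r m, le_rfl, h⟩

theorem skip (h : Q s) : Runs O .skip s 1 Q :=
  ⟨_, _, .skip s, le_rfl, h⟩

theorem seq (h : Runs O P s T fun s' => Runs O P' s' T' Q) : Runs O (.seq P P') s (T + T') Q := by
  obtain ⟨s', t, he, ht, s'', t', he', ht', hq⟩ := h
  exact ⟨s'', t + t', .seq he he', by omega, hq⟩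

theorem ite {e : Expr} (h : e.val s ≠ 0 → Runs O P s T Q) (h' : e.val s = 0 → Runs O P' s T Q) :
    Runs O (.ite e P P') s (T + 1) Q := by
  by_cases h0 : e.val s = 0
  · obtain ⟨s', t, he, ht, hq⟩ := h' h0
    exact ⟨s', t + 1, .ite_false h0 he, by omega, hq⟩
  · obtain ⟨s', t, he, ht, hq⟩ := h h0
    exact ⟨s', t + 1, .ite_true h0 he, by omega, hq⟩

/-- A loop whose body preserves `Inv` and decreases the measure `μ`. -/
theorem loop {e : Expr} {Inv : Store → Prop} {μ : Store → ℕ}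
    (hbody : ∀ s, Inv s → e.val s ≠ 0 → Runs O P s T fun s' => Inv s' ∧ μ s' < μ s) (hs : Inv s) :
    Runs O (.loop e P) s (μ s * (T + 1) + 1) fun s' => Inv s' ∧ e.val s' = 0 := by
  induction hm : μ s using Nat.strong_induction_on generalizing s with
  | _ m ih =>
    subst hm
    by_cases h0 : e.val s = 0
    · exact ⟨s, 1, .loop_done h0, by omega, hs, h0⟩
    · obtain ⟨s', t, he, ht, hi, hlt⟩ := hbody s hs h0
      obtain ⟨s'', t', he', ht', hq⟩ := ih _ hlt hi rfl
      refine ⟨s'', _, .loop_step h0 he he', ?_, hq⟩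
      have : (μ s' + 1) * (T + 1) ≤ μ s * (T + 1) := Nat.mul_le_mul_right _ hlt
      linarith

end Runs

/-- The content of cell `(0, 0)` of array `x`. -/
abbrev Expr.var (x : ℕ) : Expr := .cell x (.const 0) (.const 0)

/-- Store the value of `e` in cell `(0, 0)` of array `x`. -/
abbrev Prog.set (x : ℕ) (e : Expr) : Prog := .assign x (.const 0) (.const 0) e

/-- Run `P` for the values `0, 1, …, e - 1` of the variable `x`. -/
def Prog.forLoop (x : ℕ) (e : Expr) (P : Prog) : Prog :=
  .seq (.set x (.const 0))
    (.loop (.sub e (.var x)) (.seq P (.set x (.add (.var x) (.const 1)))))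

/-- `Inv i` speaks of the state in which the counter already holds `i`, hence the write in the
conclusion of `hbody`. Each pass pays for the test and the increment; the final `2` pays for the
initialization and the last test. -/
theorem Runs.forLoop {O : Finset ℕ → Prop} {P : Prog} {s : Store} {T x N : ℕ} {e : Expr}
    (Inv : ℕ → Store → Prop) (he : ∀ i s, Inv i s → e.val s = N)
    (h0 : Inv 0 (s.write x 0 0 0))
    (hbody : ∀ i s, i < N → s x 0 0 = i → Inv i s →
      Runs O P s T fun s' => s' x 0 0 = i ∧ Inv (i + 1) (s'.write x 0 0 (i + 1))) :
    Runs O (.forLoop x e P) s (N * (T + 2) + 2) (Inv N) := by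
  have key := Runs.loop (O := O) (P := .seq P (.set x (.add (.var x) (.const 1))))
    (e := .sub e (.var x)) (T := T + 1) (s := s.write x 0 0 0)
    (Inv := fun s => s x 0 0 ≤ N ∧ Inv (s x 0 0) s) (μ := fun s => N - s x 0 0) ?_ ?_
  · have h := Runs.seq (O := O) (T := 1) (s := s) (P := .set x (.const 0)) (Runs.assign key)
    refine h.mono ?_ ?_
    · simp only [Store.write]
      simp
      linarith
    · rintro s' ⟨⟨hle, hi⟩, hz⟩
      have := he _ _ hi
      simp only [Expr.val] at hz
      rwa [show s' x 0 0 = N by omega] at hi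
  · rintro s ⟨hle, hi⟩ hne
    have hN := he _ _ hi
    simp only [Expr.val] at hne
    refine Runs.seq ((hbody _ s (by omega) rfl hi).mono le_rfl ?_)
    rintro s' ⟨hx, hi'⟩
    refine Runs.assign ?_
    simp only [Expr.val, Store.write, hx]
    refine ⟨⟨by simp; omega, ?_⟩, by simp; omega⟩
    simpa [Store.write] using hi'
  · simpa [Store.write] using h0

/-! ### Labelled partial colorings -/

section Labels

variable {n : ℕ} (G : SimpleGraph (Fin n)) [DecidableRel G.Adj] (M : Matroid (Fin n))

/-- The members of `S` with label at least `j`. -/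
def highPart (S : Set (Fin n)) (g : Fin n → ℕ) (j : ℕ) : Set (Fin n) :=
  {w | w ∈ S ∧ j ≤ g w}

/-- No neighbor of `v` lies in `S`. -/
def Unblocked (v : Fin n) (S : Set (Fin n)) : Prop :=
  ∀ w, G.Adj v w → w ∉ S

open Classical in
/-- The classes `I 0, …, I (D - 1)` are disjoint (`col` tells the class of an element) and
independent in `G` and in `M`. An element with label above `j` is spanned by the part of labels at
least `j` of all but at most `maxDegree` classes. -/
structure Labelled (D : ℕ) (I : ℕ → Set (Fin n)) (col g : Fin n → ℕ) : Prop where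
  col_eq : ∀ c < D, ∀ u ∈ I c, col u = c
  indep : ∀ c < D, M.Indep (I c)
  graph_indep : ∀ c < D, G.IsIndepSet (I c)
  one_le : ∀ u, 1 ≤ g u
  le : ∀ u, g u ≤ n + 1
  spanned : ∀ u j, 1 ≤ j → j < g u →
    D ≤ G.maxDegree +
      ((Finset.range D).filter fun c => u ∈ M.closure (highPart (I c) g j)).card

variable {G M}

theorem Labelled.initial {D : ℕ} {I : ℕ → Set (Fin n)} {col g : Fin n → ℕ}
    (hI : ∀ c < D, I c = ∅) (hg : ∀ u, g u = 1) : Labelled G M D I col g where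
  col_eq c hc u hu := by simp [hI c hc] at hu
  indep c hc := by simp [hI c hc]
  graph_indep c hc := by simp [hI c hc, SimpleGraph.IsIndepSet]
  one_le u := (hg u).ge
  le u := by simp [hg]
  spanned u j h1 h2 := by have := hg u; omega

/-- All but at most `maxDegree` classes are unblocked for `v`. -/
theorem card_unblocked {D : ℕ} {I : ℕ → Set (Fin n)} {col g : Fin n → ℕ}
    (h : Labelled G M D I col g) (v : Fin n) (p : ℕ → Prop) [DecidablePred p]
    (hp : ∀ c < D, Unblocked G v (I c) → p c) :
    D ≤ G.maxDegree + ((Finset.range D).filter p).card := by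
  classical
  -- A blocked class contains a neighbor of `v`, and the color of that neighbor determines the
  -- class.
  have hsub : (Finset.range D).filter (fun c => ¬ p c) ⊆ (G.neighborFinset v).image col := by
    intro c hc
    simp only [Finset.mem_filter, Finset.mem_range] at hc
    have : ¬ Unblocked G v (I c) := fun hu => hc.2 (hp c hc.1 hu)
    simp only [Unblocked, not_forall, not_not] at this
    obtain ⟨w, hw, hwI⟩ := this
    exact Finset.mem_image.2 ⟨w, by simpa using hw, h.col_eq c hc.1 w hwI⟩
  have h1 := (Finset.card_le_card hsub).trans Finset.card_image_le
  have h2 := G.degree_le_maxDegree v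
  rw [← G.card_neighborFinset_eq_degree v] at h2
  have h3 := Finset.card_filter_add_card_filter_not (s := Finset.range D) p
  rw [Finset.card_range] at h3
  omega

/-- If every exchange of `v` into the independent set `S` evicts an element of label at least `l`,
then the elements with such labels span `v`. -/
theorem mem_closure_highPart (hE : M.E = Set.univ) {S : Set (Fin n)} (hS : M.Indep S)
    {v : Fin n} {g : Fin n → ℕ} {l : ℕ} (hins : ¬ M.Indep (insert v S))
    (hmin : ∀ x, M.Indep (insert v (S \ {x})) → l ≤ g x) :
    v ∈ M.closure (highPart S g l) := by
  by_contra hv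
  have hvE : ∀ e, e ∈ M.E := fun e => by simp [hE]
  have hvS : v ∉ S := fun h => hins (by rwa [Set.insert_eq_of_mem h])
  have hsub : highPart S g l ⊆ S := fun w hw => hw.1
  have hX : M.Indep (insert v (highPart S g l)) := by
    rw [(hS.subset hsub).insert_indep_iff]
    exact Or.inl ⟨hvE v, hv⟩
  have hvcl : v ∈ M.closure S := by
    by_contra h
    exact hins (hS.insert_indep_iff.2 (Or.inl ⟨hvE v, h⟩))
  -- The fundamental circuit of `v` is dependent, so some `x` in it avoids the independent set
  -- formed by `v` and the high part. Since `v` can replace this `x`, its label is at least `l`, a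
  -- contradiction.
  have hC := hS.fundCircuit_isCircuit hvcl hvS
  obtain ⟨x, hxC, hxX⟩ : ∃ x ∈ M.fundCircuit v S, x ∉ insert v (highPart S g l) := by
    by_contra! hcon
    exact hC.not_indep (hX.subset hcon)
  have hxv : x ≠ v := fun h => hxX (by simp [h])
  rw [hS.mem_fundCircuit_iff hvcl hvS] at hxC
  have hxS : x ∈ S := by
    by_contra hxS
    refine hins (hxC.subset fun y hy => ⟨hy, ?_⟩)
    rintro rfl
    exact hy.elim hxv hxS
  rw [← Set.insert_sdiff_singleton_comm (Ne.symm hxv)] at hxC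
  exact hxX (Or.inr ⟨hxS, hmin x hxC⟩)

/-- Inserting `v` into the class `I c` in exchange for the elements of `R` (at most one element,
of least possible label `l`). -/
theorem Labelled.exchange (hE : M.E = Set.univ) {D : ℕ} {I I' : ℕ → Set (Fin n)}
    {col col' g g' : Fin n → ℕ} (h : Labelled G M D I col g) {v : Fin n} {c l : ℕ}
    {R : Set (Fin n)} (hv : ∀ c < D, v ∉ I c) (hc : Unblocked G v (I c))
    (hind : M.Indep (insert v (I c \ R)))
    (hR : ∀ u ∈ R, g u = l ∧ R = {u}) (hl : l ≤ n)
    (hfree : ∀ c < D, Unblocked G v (I c) → M.Indep (insert v (I c)) → l = 0)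
    (hmin : ∀ c < D, Unblocked G v (I c) → ∀ x, M.Indep (insert v (I c \ {x})) → l ≤ g x)
    (hI' : ∀ c' < D, I' c' = if c' = c then insert v (I c \ R) else I c')
    (hcol' : ∀ u, col' u = if u = v then c else col u)
    (hg' : ∀ u, g' u = if u = v then max (g v) (l + 1) else g u) :
    Labelled G M D I' col' g' := by
  classical
  have hE' : ∀ e, e ∈ M.E := fun e => by simp [hE]
  have hgg : ∀ u, g u ≤ g' u := fun u => by
    rw [hg']; split_ifs with hu
    · subst hu; exact le_max_left _ _
    · exact le_rfl
  have hspan : ∀ c' < D, Unblocked G v (I c') → ∀ j, 1 ≤ j → j ≤ l →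
      v ∈ M.closure (highPart (I c') g j) := fun c' hc' hu j h1 hj =>
    mem_closure_highPart hE (h.indep c' hc') (fun hi => by have := hfree c' hc' hu hi; omega)
      fun x hx => hj.trans (hmin c' hc' hu x hx)
  have hmono : ∀ c' < D, ∀ j, 1 ≤ j →
      M.closure (highPart (I c') g j) ⊆ M.closure (highPart (I' c') g' j) := by
    intro c' hc' j hj
    apply M.closure_subset_closure_of_subset_closure
    intro w hw
    by_cases hcc : c' = c
    swap
    · refine M.mem_closure_of_mem' ?_ (hE' _)
      exact ⟨by rw [hI' c' hc', if_neg hcc]; exact hw.1, hw.2.trans (hgg w)⟩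
    subst hcc
    have hI : I' c' = insert v (I c' \ R) := by rw [hI' c' hc', if_pos rfl]
    by_cases hwR : w ∈ R
    swap
    · refine M.mem_closure_of_mem' ?_ (hE' _)
      exact ⟨by rw [hI]; exact Or.inr ⟨hw.1, hwR⟩, hw.2.trans (hgg w)⟩
    obtain ⟨hwl, rfl⟩ := hR w hwR
    have hvcl := hspan c' hc' hc j hj (hwl ▸ hw.2)
    -- The evicted `w` belongs to the high part, which spans `v`, while `X` alone does not. By the
    -- exchange property `w` is spanned by `X` and `v`, and the new label of `v` exceeds `l ≥ j`.
    set X := highPart (I c') g j \ {w} with hXdef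
    have hXw : insert w X = highPart (I c') g j := by
      rw [hXdef, Set.insert_sdiff_singleton, Set.insert_eq_of_mem hw]
    have hvX : v ∉ M.closure X := by
      intro hvX
      have hsub : insert v X ⊆ insert v (I c' \ {w}) :=
        Set.insert_subset_insert fun y hy => ⟨hy.1.1, hy.2⟩
      have hXi := hind.subset hsub
      refine (hXi.notMem_closure_sdiff_of_mem (Set.mem_insert v X)) ?_
      refine M.closure_subset_closure ?_ hvX
      intro y hy
      refine ⟨Or.inr hy, ?_⟩
      rintro rfl
      exact hv c' hc' hy.1.1
    have := (M.closure_exchange ⟨hXw ▸ hvcl, hvX⟩).1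
    refine M.closure_subset_closure ?_ this
    rintro y (rfl | hy)
    · refine ⟨by rw [hI]; exact Or.inl rfl, ?_⟩
      rw [hg', if_pos rfl]
      have := hw.2
      exact le_max_of_le_right (by omega)
    · exact ⟨by rw [hI]; exact Or.inr ⟨hy.1.1, hy.2⟩, hy.1.2.trans (hgg y)⟩
  refine ⟨?_, ?_, ?_, fun u => (h.one_le u).trans (hgg u), ?_, ?_⟩
  · intro c' hc' u hu
    rw [hI' c' hc'] at hu
    rw [hcol']
    by_cases h1 : c' = c <;> by_cases h2 : u = v
    · rw [if_pos h2, h1]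
    · rw [if_pos h1] at hu
      rw [if_neg h2]
      exact h.col_eq _ hc' u (h1 ▸ (hu.resolve_left h2).1)
    · rw [if_neg h1] at hu
      exact absurd (h2 ▸ hu) (hv c' hc')
    · rw [if_neg h1] at hu
      rw [if_neg h2]
      exact h.col_eq _ hc' u hu
  · intro c' hc'
    rw [hI' c' hc']
    split_ifs with h1
    · exact hind
    · exact h.indep c' hc'
  · intro c' hc'
    rw [hI' c' hc']
    split_ifs with h1
    · subst h1
      rintro x (rfl | hx) y (rfl | hy) hne
      · exact absurd rfl hne
      · exact fun ha => hc y ha hy.1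
      · exact fun ha => hc x ha.symm hx.1
      · exact h.graph_indep c' hc' hx.1 hy.1 hne
    · exact h.graph_indep c' hc'
  · intro u
    rw [hg']
    split_ifs with hu
    · exact max_le (h.le v) (by omega)
    · exact h.le u
  · intro u j h1 h2
    by_cases hju : j < g u
    · refine (h.spanned u j h1 hju).trans (Nat.add_le_add_left (Finset.card_le_card ?_) _)
      intro c' hc'
      simp only [Finset.mem_filter, Finset.mem_range] at hc' ⊢
      exact ⟨hc'.1, hmono c' hc'.1 j h1 hc'.2⟩
    -- Only `v` can pass a new level `j`; then `j ≤ l`, so every unblocked class spans it.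
    · rw [hg'] at h2
      split_ifs at h2 with huv
      · subst huv
        refine card_unblocked h u _ fun c' hc' hub => hmono c' hc' j h1 ?_
        refine hspan c' hc' hub j h1 ?_
        rw [lt_max_iff] at h2
        omega
      · exact absurd h2 hju

/-! ### Bounding the labels by counting -/

/-- A set spanned by the independent set `S` is at most `k` times as large as `S`. -/
theorem card_le_of_subset_closure {k : ℕ} {f : Fin n → Fin k} (hf : IsColoring (matroidSystem M) f)
    {X S : Finset (Fin n)} (hS : M.Indep (S : Set (Fin n)))
    (hX : (X : Set (Fin n)) ⊆ M.closure S) : X.card ≤ k * S.card := by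
  classical
  have h1 : X.card = ∑ i : Fin k, (X.filter fun x => f x = i).card :=
    Finset.card_eq_sum_card_fiberwise (t := Finset.univ) fun _ _ => by simp
  rw [h1]
  have h2 : ∀ i ∈ (Finset.univ : Finset (Fin k)), (X.filter fun x => f x = i).card ≤ S.card := by
    intro i _
    have hi : M.Indep ((X.filter fun x => f x = i : Finset (Fin n)) : Set (Fin n)) :=
      (hf i).subset fun x hx => by simpa using (Finset.mem_filter.1 hx).2
    have hle := hi.encard_le_eRk_of_subset
      (show ((X.filter fun x => f x = i : Finset (Fin n)) : Set (Fin n)) ⊆ M.closure S from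
        fun x hx => hX (Finset.mem_filter.1 hx).1)
    rw [M.eRk_closure_eq, hS.eRk_eq_encard, Set.encard_coe_eq_coe_finsetCard,
      Set.encard_coe_eq_coe_finsetCard] at hle
    exact_mod_cast hle
  calc _ ≤ ∑ _i : Fin k, S.card := Finset.sum_le_sum h2
    _ = k * S.card := by simp

/-- With more than `maxDegree + k` classes, labels are at most `n`. -/
theorem Labelled.label_le {D k : ℕ} {I : ℕ → Set (Fin n)} {col g : Fin n → ℕ}
    (h : Labelled G M D I col g) {f : Fin n → Fin k} (hf : IsColoring (matroidSystem M) f)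
    (hD : G.maxDegree + k + 1 ≤ D) (u : Fin n) : g u ≤ n := by
  classical
  let V : ℕ → Finset (Fin n) := fun j => Finset.univ.filter fun u => j ≤ g u
  have hstep : ∀ j, 1 ≤ j → (k + 1) * (V (j + 1)).card ≤ k * (V j).card := by
    intro j hj
    let S : ℕ → Finset (Fin n) := fun c => (V j).filter fun w => w ∈ I c
    have hSeq : ∀ c, (S c : Set (Fin n)) = highPart (I c) g j := fun c => by
      ext w; simp [S, V, highPart, and_comm]
    let X : ℕ → Finset (Fin n) := fun c =>
      (V (j + 1)).filter fun w => w ∈ M.closure (highPart (I c) g j)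
    have hX : ∀ c ∈ Finset.range D, (X c).card ≤ k * (S c).card := by
      intro c hc
      refine card_le_of_subset_closure hf ?_ ?_
      · rw [hSeq]
        exact (h.indep c (Finset.mem_range.1 hc)).subset fun w hw => hw.1
      · rw [hSeq]
        exact fun w hw => (Finset.mem_filter.1 hw).2
    have hsumS : ∑ c ∈ Finset.range D, (S c).card ≤ (V j).card := by
      rw [← Finset.card_biUnion]
      · exact Finset.card_le_card (Finset.biUnion_subset.2 fun c _ => Finset.filter_subset _ _)
      · intro c hc c' hc' hne
        refine Finset.disjoint_left.2 fun w hw hw' => hne ?_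
        rw [← h.col_eq c (by simpa using hc) w (Finset.mem_filter.1 hw).2,
          h.col_eq c' (by simpa using hc') w (Finset.mem_filter.1 hw').2]
    -- Double counting of the pairs of an element and a class whose high part spans it.
    have hsumX : (V (j + 1)).card * (k + 1) ≤ ∑ c ∈ Finset.range D, (X c).card := by
      have : ∑ c ∈ Finset.range D, (X c).card = ∑ w ∈ V (j + 1),
          ((Finset.range D).filter fun c => w ∈ M.closure (highPart (I c) g j)).card := by
        simp only [X, Finset.card_filter]
        exact Finset.sum_comm
      rw [this, ← smul_eq_mul]
      refine Finset.card_nsmul_le_sum _ _ _ fun w hw => ?_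
      have hw' : j + 1 ≤ g w := by simpa [V] using hw
      have := h.spanned w j hj hw'
      omega
    calc (k + 1) * (V (j + 1)).card ≤ ∑ c ∈ Finset.range D, (X c).card := by
          rw [mul_comm]; exact hsumX
      _ ≤ ∑ c ∈ Finset.range D, k * (S c).card := Finset.sum_le_sum hX
      _ = k * ∑ c ∈ Finset.range D, (S c).card := by rw [Finset.mul_sum]
      _ ≤ _ := Nat.mul_le_mul_left _ hsumS
  -- By `hstep` a nonempty level is strictly smaller than the preceding one.
  have hcard : ∀ j, j ≤ n → (V (j + 1)).card + j ≤ n := by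
    intro j
    induction j with
    | zero => intro _; simpa using (V 1).card_le_univ
    | succ j ih =>
      intro hj
      have h1 := ih (by omega)
      have h2 := hstep (j + 1) (by omega)
      by_contra! hcon
      have h3 : (V (j + 1)).card ≤ (V (j + 1 + 1)).card := by omega
      have h4 := Nat.mul_le_mul_left k h3
      have h5 : 0 < (V (j + 1 + 1)).card := by omega
      nlinarith
  by_contra! hu
  have h1 := hcard n le_rfl
  have h2 : u ∈ V (n + 1) := by simpa [V] using hu
  have := Finset.card_pos.2 ⟨u, h2⟩
  omega

/-- With more than `maxDegree` classes, some exchange is possible. -/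
theorem Labelled.exists_exchange (hE : M.E = Set.univ) (hM : M.Loopless) {D : ℕ}
    {I : ℕ → Set (Fin n)} {col g : Fin n → ℕ} (h : Labelled G M D I col g)
    (hD : G.maxDegree < D) (v : Fin n) :
    ∃ c < D, Unblocked G v (I c) ∧
      (M.Indep (insert v (I c)) ∨ ∃ x, M.Indep (insert v (I c \ {x}))) := by
  classical
  obtain ⟨c, hc, hub⟩ : ∃ c < D, Unblocked G v (I c) := by
    by_contra! hcon
    have := card_unblocked h v (fun _ => False) fun c hc hu => hcon c hc hu
    simp at this
    omega
  refine ⟨c, hc, hub, or_iff_not_imp_left.2 fun hins => ?_⟩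
  by_contra! hcon
  -- With all labels 0 and `l = 1` the high part is empty, so `v` would be a loop.
  have := mem_closure_highPart hE (h.indep c hc) (g := fun _ => 0) (l := 1) hins
    fun x hx => absurd hx (hcon x)
  have hempty : highPart (I c) (fun _ => 0) 1 = ∅ := by ext; simp [highPart]
  rw [hempty] at this
  exact (M.isNonloop_of_loopless (by simp [hE] : v ∈ M.E)).not_isLoop this

/-- Without loops the singletons form a coloring, so the infimum is attained. -/
theorem exists_isColoring_chromaticNum (hE : M.E = Set.univ) (hM : M.Loopless) :
    ∃ f : Fin n → Fin (chromaticNum (matroidSystem M)), IsColoring (matroidSystem M) f := by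
  refine Nat.sInf_mem (s := {k | ∃ f : Fin n → Fin k, IsColoring (matroidSystem M) f})
    ⟨n, id, fun i => ?_⟩
  simpa [matroidSystem] using M.isNonloop_of_loopless (by simp [hE] : i ∈ M.E)

theorem chromaticNum_le (hE : M.E = Set.univ) (hM : M.Loopless) :
    chromaticNum (matroidSystem M) ≤ n := by
  refine Nat.sInf_le ⟨id, fun i => ?_⟩
  simpa [matroidSystem] using M.isNonloop_of_loopless (by simp [hE] : i ∈ M.E)

end Labels

/-! ### The program

Arrays `3` and `4` hold the membership matrix of the color classes and the labels, with a dummy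
element `n` of label `0`. Variables: `5` the number of colors, `6` and `7` the color and the element
that are tried, `8` a flag for blocked colors, `9`, `10`, `11` the label, color and element of the
best exchange, `12` the answer of the oracle, `13` a saved entry, `14` the element to be colored,
`15` the number of elements colored, `16` a neighbor. -/

namespace Prog

open Expr

/-- Set variable `8` to `1` if color `6` occurs at a neighbor of element `14`, else to `0`. -/
def testBlocked : Prog :=
  .seq (set 8 (.const 0)) (forLoop 16 (var 0)
    (.ite (.cell 1 (var 14) (var 16))
      (.ite (.cell 3 (var 6) (var 16)) (set 8 (.const 1)) .skip) .skip))

/-- Ask whether element `14` can replace element `7` in color class `6`; if so, and if the label of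
element `7` is less than the best one so far, record this exchange. -/
def tryExchange : Prog :=
  .seq (set 13 (.cell 3 (var 6) (var 7))) <|
  .seq (.assign 3 (var 6) (var 7) (.const 0)) <|
  .seq (.assign 3 (var 6) (var 14) (.const 1)) <|
  .seq (.query 12 3 (var 6) (var 0)) <|
  .seq (.assign 3 (var 6) (var 14) (.const 0)) <|
  .seq (.assign 3 (var 6) (var 7) (var 13)) <|
  .ite (var 12)
    (.ite (.sub (var 9) (.cell 4 (.const 0) (var 7)))
      (.seq (set 9 (.cell 4 (.const 0) (var 7))) (.seq (set 10 (var 6)) (set 11 (var 7)))) .skip)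
    .skip

/-- Find an exchange of least label for element `14`. -/
def findExchange : Prog :=
  .seq (set 9 (.add (var 0) (.const 1))) <|
  forLoop 6 (var 5) <|
  .seq testBlocked <|
  .ite (var 8) .skip (forLoop 7 (.add (var 0) (.const 1)) tryExchange)

/-- Perform the recorded exchange. -/
def applyExchange : Prog :=
  .seq (.assign 3 (var 10) (var 11) (.const 0)) <|
  .seq (.assign 3 (var 10) (var 14) (.const 1)) <|
  .seq (.assign 2 (.const 0) (var 14) (var 10)) <|
  .seq (.assign 4 (.const 0) (var 14) (.add (.cell 4 (.const 0) (var 14))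
    (.sub (.add (.cell 4 (.const 0) (var 11)) (.const 1)) (.cell 4 (.const 0) (var 14))))) <|
  .ite (.sub (var 0) (var 11)) (set 14 (var 11))
    (.seq (set 15 (.add (var 15) (.const 1))) (set 14 (var 15)))

/-- Start afresh with one more color. -/
def restart : Prog :=
  .seq (set 5 (.add (var 5) (.const 1))) <|
  .seq (.assign 4 (.const 0) (var 0) (.const 0)) <|
  .seq (forLoop 7 (var 0) (.seq (.assign 4 (.const 0) (var 7) (.const 1))
    (forLoop 6 (var 5) (.assign 3 (var 6) (var 7) (.const 0))))) <|
  .seq (set 15 (.const 0)) (set 14 (.const 0))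

/-- One round of the main loop. -/
def round : Prog :=
  .seq findExchange (.ite (.sub (.add (var 0) (.const 1)) (var 9)) applyExchange restart)

/-- The coloring algorithm. -/
def coloring : Prog :=
  .seq restart (.loop (.sub (var 0) (var 15)) round)

end Prog

/-! ### Memory left unchanged by a run -/

/-- `s'` agrees with `s` except in the arrays of the list `X`. -/
def Frame (X : List ℕ) (s s' : Store) : Prop :=
  ∀ a, a ∉ X → s' a = s a

theorem Store.write_of_ne (s : Store) {a b : ℕ} (h : b ≠ a) (i j x : ℕ) :
    s.write a i j x b = s b := by
  funext i' j'
  simp [Store.write, h]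

theorem Store.write_var (s : Store) (a x : ℕ) : s.write a 0 0 x a 0 0 = x := by
  simp [Store.write]

namespace Frame

variable {X : List ℕ} {s s' s'' : Store}

theorem refl (X : List ℕ) (s : Store) : Frame X s s := fun _ _ => rfl

theorem trans (h : Frame X s s') (h' : Frame X s' s'') : Frame X s s'' := fun a ha =>
  (h' a ha).trans (h a ha)

theorem mono {Y : List ℕ} (h : Frame X s s') (hXY : X ⊆ Y) : Frame Y s s' := fun a ha =>
  h a fun ha' => ha (hXY ha')

theorem write (h : Frame X s s') {a : ℕ} (ha : a ∈ X) (i j x : ℕ) :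
    Frame X s (s'.write a i j x) := fun b hb => by
  rw [Store.write_of_ne _ (by rintro rfl; exact hb ha)]
  exact h b hb

end Frame

/-- The color class `c` in memory state `s`. -/
def row (n : ℕ) (s : Store) (c : ℕ) : Set (Fin n) :=
  {u | s 3 c u ≠ 0}

/-! ### Correctness of the blocking test and of one exchange attempt -/

section Verification

variable {n : ℕ} {G : SimpleGraph (Fin n)} [DecidableRel G.Adj] {M : Matroid (Fin n)}

theorem indepOracle_querySet (s : Store) (c : ℕ) :
    indepOracle M (querySet s 3 c n) ↔ M.Indep (row n s c) := by
  simp [indepOracle, querySet, row]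

/-- The class `c` with `v` put in and the element with number `u` taken out. -/
def exchanged (s : Store) (v : Fin n) (c u : ℕ) : Set (Fin n) :=
  insert v (row n s c \ {w | (w : ℕ) = u})

theorem row_write_write (s : Store) (v : Fin n) (c u c' : ℕ) :
    row n ((s.write 3 c u 0).write 3 c v 1) c' =
      if c' = c then exchanged s v c u else row n s c' := by
  ext w
  by_cases hc : c' = c
  · subst hc
    by_cases hw : w = v
    · simp [row, Store.write, exchanged, hw]
    · have hwv : (w : ℕ) ≠ v := fun h => hw (Fin.ext h)
      simp only [row, Store.write, exchanged, Set.mem_ofPred_eq, Set.mem_insert_iff, hw, hwv,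
        Set.mem_sdiff, if_true, true_and, false_or, if_false]
      by_cases hu : (w : ℕ) = u <;> simp [hu]
  · simp [row, Store.write, hc]

theorem runs_testBlocked {s : Store} {v : Fin n} {c : ℕ} (O : Finset ℕ → Prop) (h0 : s 0 0 0 = n)
    (h1 : s 1 = graphInput G 1) (h14 : s 14 0 0 = v) (h6 : s 6 0 0 = c) :
    Runs O .testBlocked s (n * 5 + 3) fun s' =>
      Frame [8, 16] s s' ∧ (s' 8 0 0 = 0 ↔ Unblocked G v (row n s c)) := by
  have hloop := Runs.forLoop (O := O) (s := s.write 8 0 0 0) (x := 16) (N := n) (T := 3)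
    (e := .var 0)
    (P := .ite (.cell 1 (.var 14) (.var 16))
      (.ite (.cell 3 (.var 6) (.var 16)) (.set 8 (.const 1)) .skip) .skip)
    (fun i s' => Frame [8, 16] s s' ∧
      (s' 8 0 0 = 0 ↔ ∀ w : Fin n, (w : ℕ) < i → G.Adj v w → w ∉ row n s c)) ?_ ?_ ?_
  · refine (Runs.seq (Runs.assign hloop)).mono (by omega) ?_
    rintro s' ⟨hF, h8⟩
    exact ⟨hF, h8.trans ⟨fun h w => h w w.2, fun h w _ => h w⟩⟩
  · rintro i s' ⟨hF, -⟩
    simp [Expr.val, hF 0, h0]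
  · refine ⟨((Frame.refl _ s).write (by simp) _ _ _).write (by simp) _ _ _, ?_⟩
    simp [Store.write]
  · rintro i s' hi h16 ⟨hF, h8⟩
    have e0 := hF 14 (by simp)
    have e1 := hF 1 (by simp)
    have e3 := hF 3 (by simp)
    have e6 := hF 6 (by simp)
    have hadj : s 1 v i ≠ 0 ↔ G.Adj v ⟨i, hi⟩ := by
      rw [h1]
      simp [graphInput, hi]
    have hstep : (∀ w : Fin n, (w : ℕ) < i + 1 → G.Adj v w → w ∉ row n s c) ↔
        (∀ w : Fin n, (w : ℕ) < i → G.Adj v w → w ∉ row n s c) ∧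
          (G.Adj v ⟨i, hi⟩ → s 3 c i = 0) := by
      constructor
      · intro h
        refine ⟨fun w hw => h w (by omega), fun ha => ?_⟩
        simpa [row] using h ⟨i, hi⟩ (by simp) ha
      · rintro ⟨h, h'⟩ w hw ha
        rcases Nat.lt_succ_iff_lt_or_eq.1 hw with hw | rfl
        · exact h w hw ha
        · simpa [row] using h' ha
    have hdone : ∀ s'' : Store, Frame [8, 16] s s'' → s'' 16 0 0 = i →
        (s'' 8 0 0 = 0 ↔ s' 8 0 0 = 0 ∧ (G.Adj v ⟨i, hi⟩ → s 3 c i = 0)) →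
        s'' 16 0 0 = i ∧ Frame [8, 16] s (s''.write 16 0 0 (i + 1)) ∧
          (s''.write 16 0 0 (i + 1) 8 0 0 = 0 ↔
            ∀ w : Fin n, (w : ℕ) < i + 1 → G.Adj v w → w ∉ row n s c) := by
      intro s'' hF' h16' h8'
      refine ⟨h16', hF'.write (by simp) _ _ _, ?_⟩
      rw [Store.write_of_ne _ (by simp), h8', hstep, h8]
    refine Runs.ite (T := 2) (fun ht => Runs.ite (T := 1) (fun ht' => Runs.assign ?_)
      fun ht' => Runs.skip ?_) fun ht => (Runs.skip ?_).mono (by omega) fun _ h => h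
    · simp only [Expr.val, e0, e1, e3, e6, h14, h6, h16] at ht ht'
      refine hdone _ (hF.write (by simp) _ _ _) ?_ ?_
      · rw [Store.write_of_ne _ (by simp), h16]
      · simp only [Expr.val, Store.write_var]
        have := hadj.1 ht
        simp [this, ht']
    · simp only [Expr.val, e3, e6, h6, h16] at ht'
      exact hdone _ hF h16 (by simp [ht'])
    · simp only [Expr.val, e0, e1, h14, h16] at ht
      refine hdone _ hF h16 ?_
      have : ¬ G.Adj v ⟨i, hi⟩ := fun h => hadj.2 h ht
      simp [this]

/-- Array `3` is changed for the query only. By `h3`, resetting the entry of `v` to 0 restores it,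
even if `u` is `v`. -/
theorem runs_tryExchange {s : Store} {v : Fin n} {c u : ℕ} (h0 : s 0 0 0 = n)
    (h14 : s 14 0 0 = v) (h6 : s 6 0 0 = c) (h7 : s 7 0 0 = u) (h3 : s 3 c v = 0) :
    Runs (indepOracle M) .tryExchange s (n + 11) fun s' =>
      Frame [9, 10, 11, 12, 13] s s' ∧
      ((M.Indep (exchanged s v c u) ∧ s 4 0 u < s 9 0 0 ∧
          s' 9 0 0 = s 4 0 u ∧ s' 10 0 0 = c ∧ s' 11 0 0 = u) ∨
        (¬ (M.Indep (exchanged s v c u) ∧ s 4 0 u < s 9 0 0) ∧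
          s' 9 0 0 = s 9 0 0 ∧ s' 10 0 0 = s 10 0 0 ∧ s' 11 0 0 = s 11 0 0)) := by
  classical
  have hlast : ∀ s₁ : Store, Frame [12, 13] s s₁ → (s₁ 12 0 0 ≠ 0 ↔ M.Indep (exchanged s v c u)) →
      Runs (indepOracle M) (.ite (.var 12)
        (.ite (.sub (.var 9) (.cell 4 (.const 0) (.var 7)))
          (.seq (.set 9 (.cell 4 (.const 0) (.var 7)))
            (.seq (.set 10 (.var 6)) (.set 11 (.var 7)))) .skip)
        .skip) s₁ 5 fun s' =>
      Frame [9, 10, 11, 12, 13] s s' ∧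
      ((M.Indep (exchanged s v c u) ∧ s 4 0 u < s 9 0 0 ∧
          s' 9 0 0 = s 4 0 u ∧ s' 10 0 0 = c ∧ s' 11 0 0 = u) ∨
        (¬ (M.Indep (exchanged s v c u) ∧ s 4 0 u < s 9 0 0) ∧
          s' 9 0 0 = s 9 0 0 ∧ s' 10 0 0 = s 10 0 0 ∧ s' 11 0 0 = s 11 0 0)) := by
    intro s₁ hF h12
    have hF' : Frame [9, 10, 11, 12, 13] s s₁ := hF.mono (by simp)
    have e4 := hF 4 (by simp)
    have e6 := hF 6 (by simp)
    have e7 := hF 7 (by simp)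
    have e9 := hF 9 (by simp)
    have e10 := hF 10 (by simp)
    have e11 := hF 11 (by simp)
    refine Runs.ite (T := 4) (fun ht => Runs.ite (T := 3)
      (fun ht' => Runs.seq (Runs.assign (Runs.seq (Runs.assign (Runs.assign ?_)))))
      fun ht' => (Runs.skip ?_).mono (by omega) fun _ h => h)
      fun ht => (Runs.skip ?_).mono (by omega) fun _ h => h
    · simp only [Expr.val, e4, e7, e9, h7] at ht ht'
      refine ⟨((hF'.write (by simp) _ _ _).write (by simp) _ _ _).write (by simp) _ _ _,
        Or.inl ⟨h12.1 ht, by omega, ?_⟩⟩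
      simp [Store.write, Expr.val, e4, e6, h6, e7, h7]
    · simp only [Expr.val, e4, e7, e9, h7] at ht'
      exact ⟨hF', Or.inr ⟨fun h => by omega, by rw [e9], by rw [e10], by rw [e11]⟩⟩
    · exact ⟨hF', Or.inr ⟨fun h => h12.2 h.1 ht, by rw [e9], by rw [e10], by rw [e11]⟩⟩
  refine Runs.mono (Runs.seq <| Runs.assign <| Runs.seq <| Runs.assign <| Runs.seq <|
    Runs.assign <| Runs.seq <| Runs.query <| Runs.seq <| Runs.assign <| Runs.seq <| Runs.assign <|
    hlast _ ?_ ?_) ?_ fun _ h => h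
  · intro a ha
    simp only [List.mem_cons, List.not_mem_nil, or_false, not_or] at ha
    funext i j
    simp only [Expr.val, Store.write, h6, h7, h14, ha, false_and, if_false]
    by_cases ha3 : a = 3
    · subst ha3
      simp
      grind
    · simp [ha3]
  · have hrow : row n (((s.write 13 0 0 (s 3 c u)).write 3 c u 0).write 3 c v 1) c =
        exchanged s v c u := by
      rw [row_write_write, if_pos rfl]
      simp [exchanged, row, Store.write]
    simp only [Expr.val]
    simp only [show ∀ (t : Store) i j x, (t.write 3 i j x) 12 = t 12 from
      fun t i j x => t.write_of_ne (by simp) i j x, Store.write_var]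
    simp [Store.write_of_ne, h6, h7, h14, h0, indepOracle_querySet, hrow]
  · simp [Expr.val, Store.write, h0]
    omega

end Verification

/-! ### The search for a least label, and restarting -/

section Verification

variable {n : ℕ} {G : SimpleGraph (Fin n)} {M : Matroid (Fin n)}

theorem row_congr {s s' : Store} (h : s' 3 = s 3) : row n s' = row n s := by
  funext c
  simp [row, h]

theorem exchanged_congr {s s' : Store} (h : s' 3 = s 3) (v : Fin n) (c u : ℕ) :
    exchanged s' v c u = exchanged s v c u := by
  simp [exchanged, row_congr h]

variable (G M) in
/-- The element with number `u` of class `c` can be replaced by `v`. -/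
def CanExchange (s : Store) (v : Fin n) (c u : ℕ) : Prop :=
  Unblocked G v (row n s c) ∧ M.Indep (exchanged s v c u)

/-- In state `s'`, the recorded exchange is one of least label among those in `C`, where the labels
are those of the state `s` and only labels up to `n` count. -/
def IsBest (n : ℕ) (s : Store) (C : ℕ → ℕ → Prop) (s' : Store) : Prop :=
  (s' 9 0 0 ≤ n → C (s' 10 0 0) (s' 11 0 0) ∧ s 4 0 (s' 11 0 0) = s' 9 0 0) ∧
    ∀ c u, C c u → s' 9 0 0 ≤ s 4 0 u

theorem IsBest.congr {s s' s'' : Store} {C C' : ℕ → ℕ → Prop} (h : IsBest n s C s')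
    (hC : ∀ c u, C c u ↔ C' c u) (h9 : s'' 9 0 0 = s' 9 0 0) (h10 : s'' 10 0 0 = s' 10 0 0)
    (h11 : s'' 11 0 0 = s' 11 0 0) : IsBest n s C' s'' := by
  obtain rfl : C = C' := by funext c u; exact propext (hC c u)
  simpa only [IsBest, h9, h10, h11] using h

/-- The index `u` runs up to and including the dummy `n`. Nonmembers of the class are tried too;
this amounts to a free insertion, for which the dummy is also a candidate. -/
theorem runs_tryExchange_loop {s s₁ : Store} {v : Fin n} {c : ℕ} (h0 : s 0 0 0 = n)
    (h14 : s 14 0 0 = v) (h3 : s 3 c v = 0) (hub : Unblocked G v (row n s c))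
    (hF : Frame [6, 7, 8, 9, 10, 11, 12, 13, 16] s s₁) (h6 : s₁ 6 0 0 = c)
    (hbest : IsBest n s (fun c' u => CanExchange G M s v c' u ∧ c' < c ∧ u ≤ n) s₁) :
    Runs (indepOracle M) (.forLoop 7 (.add (.var 0) (.const 1)) .tryExchange) s₁
      ((n + 1) * (n + 11 + 2) + 2) fun s' =>
      Frame [6, 7, 8, 9, 10, 11, 12, 13, 16] s s' ∧ s' 6 0 0 = c ∧
        IsBest n s (fun c' u => CanExchange G M s v c' u ∧ c' < c + 1 ∧ u ≤ n) s' := by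
  refine Runs.mono (Runs.forLoop (fun i s' =>
    Frame [6, 7, 8, 9, 10, 11, 12, 13, 16] s s' ∧ s' 6 0 0 = c ∧
      IsBest n s (fun c' u => CanExchange G M s v c' u ∧ (c' < c ∧ u ≤ n ∨ c' = c ∧ u < i)) s')
      ?_ ?_ ?_) le_rfl ?_
  · rintro i s' ⟨hF', -, -⟩
    simp [Expr.val, hF' 0, h0]
  · refine ⟨hF.write (by simp) _ _ _, by simpa [Store.write] using h6, ?_⟩
    refine hbest.congr ?_ ?_ ?_ ?_ <;> simp [Store.write]
  · rintro i s' hi h7 ⟨hF', h6', hb⟩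
    have e0 := hF' 0 (by simp)
    have e3 := hF' 3 (by simp)
    have e4 := hF' 4 (by simp)
    have e14 := hF' 14 (by simp)
    refine (runs_tryExchange (M := M) (v := v) (c := c) (u := i) (by rw [e0, h0])
      (by rw [e14, h14]) h6' h7 (by rw [e3, h3])).mono le_rfl ?_
    rintro s'' ⟨hF'', hcase⟩
    have hF3 : Frame [6, 7, 8, 9, 10, 11, 12, 13, 16] s s'' := hF'.trans (hF''.mono (by simp))
    refine ⟨by rw [hF'' 7 (by simp), h7], hF3.write (by simp) _ _ _, ?_, ?_⟩
    · rw [Store.write_of_ne _ (by simp), hF'' 6 (by simp), h6']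
    · rw [exchanged_congr e3, e4] at hcase
      suffices h : IsBest n s (fun c' u => CanExchange G M s v c' u ∧
          (c' < c ∧ u ≤ n ∨ c' = c ∧ u < i + 1)) s'' by
        refine h.congr (fun _ _ => Iff.rfl) ?_ ?_ ?_ <;> simp [Store.write]
      obtain ⟨hb1, hb2⟩ := hb
      rcases hcase with ⟨hind, hlt, q9, q10, q11⟩ | ⟨hnot, q9, q10, q11⟩
      · refine ⟨fun _ => ?_, ?_⟩
        · rw [q9, q10, q11]
          exact ⟨⟨⟨hub, hind⟩, Or.inr ⟨rfl, by omega⟩⟩, rfl⟩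
        · rintro c' u ⟨hcan, hcu⟩
          rw [q9]
          by_cases hnew : c' = c ∧ u = i
          · rw [hnew.2]
          · exact hlt.le.trans (hb2 c' u ⟨hcan, by omega⟩)
      · refine ⟨fun hle => ?_, ?_⟩
        · rw [q9] at hle
          obtain ⟨⟨h1, h2⟩, h3⟩ := hb1 hle
          rw [q9, q10, q11]
          exact ⟨⟨h1, by omega⟩, h3⟩
        · rintro c' u ⟨hcan, hcu⟩
          rw [q9]
          by_cases hnew : c' = c ∧ u = i
          · obtain ⟨rfl, rfl⟩ := hnew
            exact not_lt.1 fun h => hnot ⟨hcan.2, h⟩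
          · exact hb2 c' u ⟨hcan, by omega⟩
  · rintro s' ⟨hF', h6', hb⟩
    exact ⟨hF', h6', hb.congr (fun c' u => and_congr_right fun _ => by omega) rfl rfl rfl⟩

theorem runs_findExchange [DecidableRel G.Adj] {s : Store} {v : Fin n} {D : ℕ} (h0 : s 0 0 0 = n)
    (h1 : s 1 = graphInput G 1) (h5 : s 5 0 0 = D) (h14 : s 14 0 0 = v)
    (h3 : ∀ c < D, s 3 c v = 0) :
    Runs (indepOracle M) .findExchange s
      (1 + (D * (n * 5 + 3 + ((n + 1) * (n + 11 + 2) + 2 + 1) + 2) + 2)) fun s' =>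
      Frame [6, 7, 8, 9, 10, 11, 12, 13, 16] s s' ∧
        IsBest n s (fun c u => CanExchange G M s v c u ∧ c < D ∧ u ≤ n) s' := by
  refine Runs.seq (Runs.assign (Runs.mono (Runs.forLoop (fun i s' =>
    Frame [6, 7, 8, 9, 10, 11, 12, 13, 16] s s' ∧
      IsBest n s (fun c u => CanExchange G M s v c u ∧ c < i ∧ u ≤ n) s')
      ?_ ?_ ?_) le_rfl fun _ h => h))
  · rintro i s' ⟨hF, -⟩
    simp [Expr.val, hF 5, h5]
  · refine ⟨((Frame.refl _ s).write (by simp) _ _ _).write (by simp) _ _ _, ?_⟩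
    -- The initial value `n + 1` of variable `9` means that no exchange has been found.
    simp [IsBest, Store.write, Expr.val, h0]
  · rintro i s' hi h6 ⟨hF, hb⟩
    have e0 := hF 0 (by simp)
    have e1 := hF 1 (by simp)
    have e3 := hF 3 (by simp)
    have e14 := hF 14 (by simp)
    refine Runs.seq ((runs_testBlocked (G := G) (v := v) (c := i) _ (by rw [e0, h0])
      (by rw [e1, h1]) (by rw [e14, h14]) h6).mono le_rfl ?_)
    rintro s₁ ⟨hF₁, h8⟩
    rw [row_congr e3] at h8
    have hF₂ : Frame [6, 7, 8, 9, 10, 11, 12, 13, 16] s s₁ := hF.trans (hF₁.mono (by simp))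
    have h6₁ : s₁ 6 0 0 = i := by rw [hF₁ 6 (by simp), h6]
    have hb₁ := hb.congr (s'' := s₁) (fun _ _ => Iff.rfl) (by rw [hF₁ 9 (by simp)])
      (by rw [hF₁ 10 (by simp)]) (by rw [hF₁ 11 (by simp)])
    refine Runs.ite (fun ht => (Runs.skip ?_).mono (by omega) fun _ h => h) fun ht =>
      (runs_tryExchange_loop h0 h14 (h3 i hi) (h8.1 ht) hF₂ h6₁ hb₁).mono le_rfl ?_
    · refine ⟨h6₁, hF₂.write (by simp) _ _ _, ?_⟩
      refine hb₁.congr (fun c u => ?_) ?_ ?_ ?_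
      · refine and_congr_right fun hcan => and_congr_left fun _ => ⟨fun h => by omega, fun h => ?_⟩
        have : c ≠ i := by
          rintro rfl
          exact ht (h8.2 hcan.1)
        omega
      all_goals simp [Store.write]
    · rintro s₂ ⟨hF₃, h6₂, hb₂⟩
      refine ⟨h6₂, hF₃.write (by simp) _ _ _, ?_⟩
      refine hb₂.congr (fun _ _ => Iff.rfl) ?_ ?_ ?_ <;> simp [Store.write]

theorem runs_restart {s : Store} {D : ℕ} (O : Finset ℕ → Prop) (h0 : s 0 0 0 = n)
    (h5 : s 5 0 0 = D) :
    Runs O .restart s (1 + (1 + (n * (1 + ((D + 1) * (1 + 2) + 2) + 2) + 2 + (1 + 1)))) fun s' =>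
      Frame [3, 4, 5, 6, 7, 14, 15] s s' ∧ s' 5 0 0 = D + 1 ∧ s' 14 0 0 = 0 ∧ s' 15 0 0 = 0 ∧
        s' 4 0 n = 0 ∧ (∀ u < n, s' 4 0 u = 1) ∧ ∀ c < D + 1, ∀ u < n, s' 3 c u = 0 := by
  refine Runs.seq <| Runs.assign <| Runs.seq <| Runs.assign <| Runs.seq <| Runs.mono
    (Runs.forLoop (fun i s' => Frame [3, 4, 5, 6, 7, 14, 15] s s' ∧ s' 5 0 0 = D + 1 ∧
      s' 4 0 n = 0 ∧ (∀ u < i, s' 4 0 u = 1) ∧ ∀ c < D + 1, ∀ u < i, s' 3 c u = 0)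
      ?_ ?_ ?_) le_rfl ?_
  · rintro i s' ⟨hF, -⟩
    simp [Expr.val, hF 0, h0]
  · refine ⟨(((Frame.refl _ s).write (by simp) _ _ _).write (by simp) _ _ _).write (by simp) _ _ _,
      ?_⟩
    simp [Store.write, Expr.val, h0, h5]
  · rintro i s' hi h7 ⟨hF, h5', h4, h4', h3⟩
    refine Runs.seq <| Runs.assign <| Runs.mono (Runs.forLoop (fun j s'' =>
      Frame [3, 4, 5, 6, 7, 14, 15] s s'' ∧ s'' 5 0 0 = D + 1 ∧ s'' 7 0 0 = i ∧
        s'' 4 0 n = 0 ∧ (∀ u < i + 1, s'' 4 0 u = 1) ∧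
        (∀ c < D + 1, ∀ u < i, s'' 3 c u = 0) ∧ ∀ c < j, s'' 3 c i = 0) ?_ ?_ ?_) le_rfl ?_
    · rintro j s'' ⟨-, h, -⟩
      simpa [Expr.val] using h
    · refine ⟨(hF.write (by simp) _ _ _).write (by simp) _ _ _, ?_, ?_, ?_, ?_, ?_, by simp⟩
      · simpa [Store.write] using h5'
      · simpa [Store.write] using h7
      · simp [Store.write, Expr.val, h7, hi.ne', h4]
      · intro u hu
        by_cases hui : u = i
        · simp [Store.write, Expr.val, h7, hui]
        · simpa [Store.write, Expr.val, h7, hui] using h4' u (by omega)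
      · simpa [Store.write] using h3
    · rintro j s'' hj h6 ⟨hF', h5'', h7', h4, h4', h3, h3'⟩
      refine Runs.assign ⟨?_, (hF'.write (by simp) _ _ _).write (by simp) _ _ _,
        ?_, ?_, ?_, ?_, ?_, ?_⟩
      · simpa [Store.write] using h6
      · simpa [Store.write] using h5''
      · simpa [Store.write] using h7'
      · simpa [Store.write] using h4
      · simpa [Store.write] using h4'
      · intro c hc u hu
        simp [Store.write, Expr.val, h3 c hc u hu]
      · intro c hc
        by_cases hcj : c = j
        · simp [Store.write, Expr.val, h6, h7', hcj]
        · simpa [Store.write, Expr.val, h6, h7', hcj] using h3' c (by omega)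
    · rintro s'' ⟨hF', h5'', h7', h4, h4', h3, h3'⟩
      refine ⟨h7', hF'.write (by simp) _ _ _, ?_, ?_, ?_, ?_⟩
      · simpa [Store.write] using h5''
      · simpa [Store.write] using h4
      · simpa [Store.write] using h4'
      · intro c hc u hu
        rcases Nat.lt_succ_iff_lt_or_eq.1 hu with hu | rfl
        · simpa [Store.write] using h3 c hc u hu
        · simpa [Store.write] using h3' c hc
  · rintro s' ⟨hF, h5', h4, h4', h3⟩
    refine Runs.seq (Runs.assign (Runs.assign
      ⟨(hF.write (by simp) _ _ _).write (by simp) _ _ _, ?_⟩))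
    simpa [Store.write, Expr.val] using
      And.intro h5' (And.intro h4 (And.intro h4' h3))

end Verification

/-! ### Loop invariant, potential and running time -/

section Verification

variable {n : ℕ} {G : SimpleGraph (Fin n)} [DecidableRel G.Adj] {M : Matroid (Fin n)}

variable (G M) in
/-- The invariant of the main loop: there are `D` color classes, and they contain the elements up to
`i` except for `v`. -/
structure Valid (D i v : ℕ) (s : Store) : Prop where
  size : s 0 0 0 = n
  graph : s 1 = graphInput G 1
  colors : s 5 0 0 = D
  current : s 14 0 0 = v
  count : s 15 0 0 = i
  le : v ≤ i
  count_le : i ≤ n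
  eq_of_eq : i = n → v = n
  dummy : s 4 0 n = 0
  labelled : Labelled G M D (row n s) (fun u => s 2 0 u) fun u => s 4 0 u
  colored : ∀ w : Fin n, (∃ c < D, w ∈ row n s c) ↔ (w : ℕ) ≤ i ∧ (w : ℕ) ≠ v

/-- The sum of the labels of the colored elements. -/
def labelSum (s : Store) : ℕ :=
  ∑ w ∈ (Finset.range (s 15 0 0 + 1)).erase (s 14 0 0), s 4 0 w

theorem Valid.labelSum_le {D i v : ℕ} {s : Store} (h : Valid G M D i v s) :
    labelSum s ≤ n * (n + 1) := by
  have hb : ∀ w ∈ (Finset.range (s 15 0 0 + 1)).erase (s 14 0 0), s 4 0 w ≤ n + 1 := by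
    intro w hw
    rw [h.count, h.current, Finset.mem_erase, Finset.mem_range] at hw
    have := h.count_le
    rcases (show w ≤ n by omega).lt_or_eq with hwn | rfl
    · exact h.labelled.le ⟨w, hwn⟩
    · rw [h.dummy]
      exact Nat.zero_le _
  have := Finset.sum_le_card_nsmul _ _ _ hb
  rw [h.count, h.current, Finset.card_erase_of_mem (by simpa [Nat.lt_succ_iff] using h.le),
    Finset.card_range, Nat.add_sub_cancel, smul_eq_mul] at this
  rw [labelSum, h.count, h.current]
  exact this.trans (Nat.mul_le_mul_right _ h.count_le)

theorem Valid.restarted {D : ℕ} {s s' : Store} (h0 : s 0 0 0 = n) (h1 : s 1 = graphInput G 1)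
    (hF : Frame [3, 4, 5, 6, 7, 14, 15] s s') (h5 : s' 5 0 0 = D) (h14 : s' 14 0 0 = 0)
    (h15 : s' 15 0 0 = 0) (h4 : s' 4 0 n = 0) (h4' : ∀ u < n, s' 4 0 u = 1)
    (h3 : ∀ c < D, ∀ u < n, s' 3 c u = 0) : Valid G M D 0 0 s' where
  size := by rw [hF 0 (by simp), h0]
  graph := by rw [hF 1 (by simp), h1]
  colors := h5
  current := h14
  count := h15
  le := le_rfl
  count_le := Nat.zero_le _
  eq_of_eq := id
  dummy := h4
  labelled := .initial (fun c hc => by ext u; simp [row, h3 c hc u u.2]) fun u => h4' u u.2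
  colored w := by
    constructor
    · rintro ⟨c, hc, hw⟩
      exact absurd (h3 c hc w w.2) hw
    · omega

theorem sum_add_of_update {A : Finset ℕ} {v : ℕ} (hv : v ∈ A) {g g' : ℕ → ℕ}
    (hg : ∀ w, w ≠ v → g' w = g w) : ∑ w ∈ A, g' w = g' v + ∑ w ∈ A.erase v, g w := by
  rw [← Finset.add_sum_erase A g' hv]
  congr 1
  exact Finset.sum_congr rfl fun w hw => hg w (Finset.ne_of_mem_erase hw)

theorem exchanged_dummy (s : Store) (v : Fin n) (c : ℕ) :
    exchanged s v c n = insert v (row n s c) := by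
  have : {w : Fin n | (w : ℕ) = n} = ∅ := by
    ext w
    simpa using w.2.ne
  simp [exchanged, this]

theorem exchanged_coe (s : Store) (v : Fin n) (c : ℕ) (u : Fin n) :
    exchanged s v c u = insert v (row n s c \ {u}) := by
  have : {w : Fin n | (w : ℕ) = u} = {u} := by
    ext w
    simp [Fin.ext_iff]
  simp [exchanged, this]

theorem Valid.runs_applyExchange (hE : M.E = Set.univ) {D i : ℕ} {v : Fin n} {s s' : Store}
    (h : Valid G M D i v s) (hi : i < n) (hF : Frame [6, 7, 8, 9, 10, 11, 12, 13, 16] s s')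
    (hbest : IsBest n s (fun c u => CanExchange G M s v c u ∧ c < D ∧ u ≤ n) s')
    (hle : s' 9 0 0 ≤ n) (O : Finset ℕ → Prop) :
    Runs O .applyExchange s' 7 fun s'' =>
      (∃ i' v', Valid G M D i' v' s'') ∧ labelSum s < labelSum s'' := by
  obtain ⟨⟨⟨⟨hub, hind⟩, hbc, hbu⟩, hkey⟩, hmin⟩ := And.imp_left (fun h => h hle) hbest
  have hv : ∀ c < D, v ∉ row n s c := fun c hc hvc => ((h.colored v).1 ⟨c, hc, hvc⟩).2 rfl
  generalize hbc' : s' 10 0 0 = bc at *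
  generalize hbu' : s' 11 0 0 = bu at *
  generalize hl : s' 9 0 0 = l at *
  have e0 := hF 0 (by simp)
  have e1 := hF 1 (by simp)
  have e2 := hF 2 (by simp)
  have e3 := hF 3 (by simp)
  have e4 := hF 4 (by simp)
  have e5 := hF 5 (by simp)
  have e14 := hF 14 (by simp)
  have e15 := hF 15 (by simp)
  have hfree : ∀ c < D, Unblocked G v (row n s c) → M.Indep (insert v (row n s c)) → l = 0 := by
    intro c hc hu hins
    have := hmin c n ⟨⟨hu, by rwa [exchanged_dummy]⟩, hc, le_rfl⟩
    rw [h.dummy] at this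
    omega
  -- If `bu` were not in the class, the exchange would be a free insertion, so `l = 0`; but labels
  -- of genuine elements are at least 1.
  have hmemR : bu < n → ∃ u : Fin n, (u : ℕ) = bu ∧ u ∈ row n s bc := by
    refine fun hlt => ⟨⟨bu, hlt⟩, rfl, ?_⟩
    by_contra hnot
    have h1 : exchanged s v bc bu = insert v (row n s bc) := by
      rw [exchanged_coe s v bc ⟨bu, hlt⟩, Set.sdiff_singleton_eq_self hnot]
    have h2 := hfree bc hbc hub (h1 ▸ hind)
    have h3 : 1 ≤ s 4 0 bu := h.labelled.one_le ⟨bu, hlt⟩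
    omega
  have hmain : ∀ t : Store, Frame [2, 3, 4] s' t →
      (∀ c, row n t c = if c = bc then exchanged s v bc bu else row n s c) →
      (∀ u, t 2 0 u = if u = v then bc else s 2 0 u) →
      (∀ u, t 4 0 u = if u = v then max (s 4 0 v) (l + 1) else s 4 0 u) →
      Labelled G M D (row n t) (fun u => t 2 0 u) fun u => t 4 0 u := by
    intro t hFt ht3 ht2 ht4
    refine h.labelled.exchange hE hv hub hind ?_ hle hfree ?_ (fun c _ => ht3 c) ?_ ?_
    · intro u hu
      have hu' : (u : ℕ) = bu := hu
      refine ⟨by rw [hu', hkey], ?_⟩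
      ext w
      simp [Fin.ext_iff, hu']
    · exact fun c hc hu x hx => hmin c x ⟨⟨hu, by rwa [exchanged_coe]⟩, hc, x.2.le⟩
    · exact fun u => by simp only [ht2, Fin.ext_iff]
    · exact fun u => by simp only [ht4, Fin.ext_iff]
  have hcolored : ∀ t : Store,
      (∀ c, row n t c = if c = bc then exchanged s v bc bu else row n s c) →
      ∀ w : Fin n, (∃ c < D, w ∈ row n t c) ↔ (w : ℕ) ≤ i ∧ (w : ℕ) ≠ bu ∨ w = v := by
    intro t ht w
    have hvi := h.le
    constructor
    · rintro ⟨c, hc, hw⟩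
      rw [ht] at hw
      split_ifs at hw with hcc
      · rcases hw with rfl | ⟨hw, hwu⟩
        · exact Or.inr rfl
        · exact Or.inl ⟨((h.colored w).1 ⟨bc, hbc, hw⟩).1, hwu⟩
      · refine Or.inl ⟨((h.colored w).1 ⟨c, hc, hw⟩).1, fun hwu => hcc ?_⟩
        obtain ⟨u, hu, hub⟩ := hmemR (hwu ▸ w.2)
        obtain rfl : u = w := Fin.ext (hu.trans hwu.symm)
        rw [← h.labelled.col_eq c hc u hw, h.labelled.col_eq bc hbc u hub]
    · by_cases hwv : w = v
      · exact fun _ => ⟨bc, hbc, by rw [ht, if_pos rfl, hwv]; exact Set.mem_insert _ _⟩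
      · rintro (⟨hwi, hwu⟩ | hw)
        · obtain ⟨c, hc, hwc⟩ := (h.colored w).2 ⟨hwi, fun h => hwv (Fin.ext h)⟩
          refine ⟨c, hc, ?_⟩
          rw [ht]
          split_ifs with hcc
          · exact Or.inr ⟨hcc ▸ hwc, hwu⟩
          · exact hwc
        · exact absurd hw hwv
  have hlast : ∀ t : Store, Frame [2, 3, 4] s' t →
      (∀ c, row n t c = if c = bc then exchanged s v bc bu else row n s c) →
      (∀ u, t 2 0 u = if u = v then bc else s 2 0 u) →
      (∀ u, t 4 0 u = if u = v then max (s 4 0 v) (l + 1) else s 4 0 u) →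
      Runs O (.ite (.sub (.var 0) (.var 11)) (.set 14 (.var 11))
        (.seq (.set 15 (.add (.var 15) (.const 1))) (.set 14 (.var 15)))) t 3 fun s'' =>
      (∃ i' v', Valid G M D i' v' s'') ∧ labelSum s < labelSum s'' := by
    intro t hFt ht3 ht2 ht4
    have hL := hmain t hFt ht3 ht2 ht4
    have hC := hcolored t ht3
    have f0 : t 0 0 0 = n := by rw [hFt 0 (by simp), e0, h.size]
    have f1 : t 1 = graphInput G 1 := by rw [hFt 1 (by simp), e1, h.graph]
    have f5 : t 5 0 0 = D := by rw [hFt 5 (by simp), e5, h.colors]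
    have f11 : t 11 0 0 = bu := by rw [hFt 11 (by simp), hbu']
    have f15 : t 15 0 0 = i := by rw [hFt 15 (by simp), e15, h.count]
    have f4 : t 4 0 n = 0 := by rw [ht4, if_neg v.2.ne', h.dummy]
    -- Both outcomes are compared with the sum over all of `0, …, i`: an eviction then loses only
    -- `l`, an insertion loses nothing, and `v` brings at least `l + 1`.
    have hsum : ∑ w ∈ Finset.range (i + 1), t 4 0 w = t 4 0 v + labelSum s := by
      rw [labelSum, h.count, h.current]
      exact sum_add_of_update (by simpa [Nat.lt_succ_iff] using h.le)
        fun w hw => by rw [ht4, if_neg hw]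
    have htv : l + 1 ≤ t 4 0 v := by
      rw [ht4, if_pos rfl]
      exact le_max_right _ _
    have hvi := h.le
    refine Runs.ite (T := 2) (fun hlt => (Runs.assign ⟨⟨i, bu, ?_⟩, ?_⟩).mono (by omega)
      fun _ h => h) fun hge => Runs.seq (Runs.assign (Runs.assign ⟨⟨i + 1, i + 1, ?_⟩, ?_⟩))
    · have hlt' : bu < n := by
        simp only [Expr.val, f0, f11] at hlt
        omega
      obtain ⟨u, hu, hur⟩ := hmemR hlt'
      obtain ⟨hui, huv⟩ := (h.colored u).1 ⟨bc, hbc, hur⟩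
      refine ⟨?_, ?_, ?_, ?_, ?_, by omega, h.count_le, by omega, ?_, ?_, ?_⟩
      · simpa [Store.write] using f0
      · simpa [Store.write_of_ne] using f1
      · simpa [Store.write] using f5
      · simpa [Store.write, Expr.val] using f11
      · simpa [Store.write_of_ne] using f15
      · simpa [Store.write] using f4
      · rw [row_congr (Store.write_of_ne _ (by simp) _ _ _)]
        simpa only [Store.write_of_ne t (a := 14) (b := 2) (by simp),
          Store.write_of_ne t (a := 14) (b := 4) (by simp)] using hL
      · intro w
        rw [row_congr (Store.write_of_ne _ (by simp) _ _ _), hC w]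
        constructor
        · rintro (hw | rfl)
          · exact hw
          · exact ⟨hvi, by omega⟩
        · exact Or.inl
    · have hlt' : bu < n := by
        simp only [Expr.val, f0, f11] at hlt
        omega
      obtain ⟨u, hu, hur⟩ := hmemR hlt'
      obtain ⟨hui, huv⟩ := (h.colored u).1 ⟨bc, hbc, hur⟩
      have hnew : labelSum (t.write 14 0 0 bu) =
          ∑ w ∈ (Finset.range (i + 1)).erase bu, t 4 0 w := by
        simp [labelSum, Store.write, f15]
      have hb := Finset.add_sum_erase (Finset.range (i + 1)) (fun w => t 4 0 w)
        (a := bu) (by simp; omega)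
      have htu : t 4 0 bu = l := by rw [ht4, if_neg (by omega), hkey]
      simp only [Expr.val, f11, hnew]
      simp only [htu] at hb
      omega
    · have hge' : bu = n := by
        simp only [Expr.val, f0, f11] at hge
        omega
      refine ⟨?_, ?_, ?_, ?_, ?_, le_rfl, hi, id, ?_, ?_, ?_⟩
      · simpa [Store.write] using f0
      · simpa [Store.write_of_ne] using f1
      · simpa [Store.write] using f5
      · simp [Store.write, Expr.val, f15]
      · simp [Store.write, Expr.val, f15]
      · simpa [Store.write] using f4
      · rw [row_congr (s := t) (by simp [Store.write_of_ne])]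
        simpa only [Store.write_of_ne _ (a := 14) (b := 2) (by simp),
          Store.write_of_ne _ (a := 14) (b := 4) (by simp),
          Store.write_of_ne _ (a := 15) (b := 2) (by simp),
          Store.write_of_ne _ (a := 15) (b := 4) (by simp)] using hL
      · intro w
        rw [row_congr (s := t) (by simp [Store.write_of_ne]), hC w]
        have := w.2
        constructor
        · rintro (hw | rfl) <;> omega
        · intro hw
          exact Or.inl (by omega)
    · have hnew : labelSum ((t.write 15 0 0 (i + 1)).write 14 0 0 (i + 1)) =
          ∑ w ∈ Finset.range (i + 1), t 4 0 w := by
        have : (Finset.range (i + 1 + 1)).erase (i + 1) = Finset.range (i + 1) := by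
          ext w
          simp
          omega
        simp [labelSum, Store.write, this]
      simp only [Expr.val, f15, Store.write_var, hnew]
      omega
  refine Runs.mono (Runs.seq <| Runs.assign <| Runs.seq <| Runs.assign <| Runs.seq <|
    Runs.assign <| Runs.seq <| Runs.assign <| hlast _ ?_ ?_ ?_ ?_) le_rfl fun _ h => h
  · exact ((((Frame.refl _ s').write (by simp) _ _ _).write (by simp) _ _ _).write
      (by simp) _ _ _).write (by simp) _ _ _
  · intro c
    have := row_write_write s' v bc bu c
    rw [row_congr e3, exchanged_congr e3] at this
    rw [← this]
    simp [Expr.val, row, Store.write, hbc', hbu', e14, h.current]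
  · intro u
    simp [Expr.val, Store.write, hbc', e14, e2, h.current]
  · intro u
    -- The program expresses the maximum by truncated subtraction.
    have hmax : ∀ a b : ℕ, a + (b - a) = max a b := by omega
    simp [Expr.val, Store.write, hbu', e14, e4, h.current, hmax, hkey]

/-- With `maxDegree + k + 1` colors, some exchange exists and all labels are at most `n`, so the
search succeeds and no restart occurs. -/
theorem Valid.runs_round (hE : M.E = Set.univ) (hM : M.Loopless) {D i v k : ℕ} {s : Store}
    {f : Fin n → Fin k} (hf : IsColoring (matroidSystem M) f) (h : Valid G M D i v s)
    (hi : i < n) :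
    Runs (indepOracle M) .round s
      (1 + (D * (n * 5 + 3 + ((n + 1) * (n + 11 + 2) + 2 + 1) + 2) + 2) +
        (7 + (n * (1 + ((D + 1) * (1 + 2) + 2) + 2) + 2 + 4) + 1))
      fun s' => (∃ i' v', Valid G M D i' v' s') ∧ labelSum s < labelSum s' ∨
        D < G.maxDegree + k + 1 ∧ Valid G M (D + 1) 0 0 s' := by
  lift v to Fin n using h.le.trans_lt hi
  have hv : ∀ c < D, v ∉ row n s c := fun c hc hvc => ((h.colored v).1 ⟨c, hc, hvc⟩).2 rfl
  refine Runs.seq ((runs_findExchange h.size h.graph h.colors h.current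
    fun c hc => by simpa [row] using hv c hc).mono le_rfl ?_)
  rintro s' ⟨hF, hbest⟩
  have e0 : s' 0 0 0 = n := by rw [hF 0 (by simp), h.size]
  refine Runs.ite (fun ht => ?_) fun ht => ?_
  · simp only [Expr.val, e0] at ht
    exact (h.runs_applyExchange hE hi hF hbest (by omega) _).mono (by omega) fun _ h => Or.inl h
  · simp only [Expr.val, e0] at ht
    refine (runs_restart (n := n) (D := D) _ e0 (by rw [hF 5 (by simp), h.colors])).mono
      (by omega) ?_
    rintro s'' ⟨hF', h5, h14, h15, h4, h4', h3⟩
    refine Or.inr ⟨?_, .restarted e0 (by rw [hF 1 (by simp), h.graph]) hF' h5 h14 h15 h4 h4' h3⟩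
    by_contra! hD
    obtain ⟨c, hc, hub, hcase⟩ := h.labelled.exists_exchange hE hM (by omega) v
    obtain ⟨u, hun, hu, hlu⟩ : ∃ u, u ≤ n ∧ M.Indep (exchanged s v c u) ∧ s 4 0 u ≤ n := by
      rcases hcase with hins | ⟨x, hx⟩
      · exact ⟨n, le_rfl, by rwa [exchanged_dummy], by rw [h.dummy]; exact Nat.zero_le _⟩
      · exact ⟨x, x.2.le, by rwa [exchanged_coe], h.labelled.label_le hf hD x⟩
    have := hbest.2 c u ⟨⟨hub, hu⟩, hc, hun⟩
    omega

/-- A bound on the number of steps of one round with at most `2 * n + 1` colors. -/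
def roundTime (n : ℕ) : ℕ :=
  1 + ((2 * n + 1) * (n * 5 + 3 + ((n + 1) * (n + 11 + 2) + 2 + 1) + 2) + 2) +
    (7 + (n * (1 + ((2 * n + 1 + 1) * (1 + 2) + 2) + 2) + 2 + 4) + 1)

theorem runs_coloring (hE : M.E = Set.univ) (hM : M.Loopless) {k : ℕ} {f : Fin n → Fin k}
    (hf : IsColoring (matroidSystem M) f) (hk : k ≤ n) :
    Runs (indepOracle M) .coloring (graphInput G)
      (8 * n + 20 + (((2 * n + 1) * (n * (n + 1) + 2) + n * (n + 1)) * (roundTime n + 1) + 1))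
      fun s => ∃ D ≤ G.maxDegree + k + 1, Valid G M D n n s := by
  have hΔ : G.maxDegree ≤ n := by
    refine SimpleGraph.maxDegree_le_of_forall_degree_le _ _ fun v => ?_
    exact (G.degree_lt_card_verts v).le.trans_eq (Fintype.card_fin n)
  set m := G.maxDegree + k + 1 with hm
  -- The input memory holds 0 as the number of colors, so the first restart begins with one color.
  refine Runs.seq ((runs_restart (n := n) (D := 0) _ (by simp [graphInput])
    (by simp [graphInput])).mono (by omega) ?_)
  rintro s ⟨hF, h5, h14, h15, h4, h4', h3⟩
  have hs : Valid G M 1 0 0 s :=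
    .restarted (by simp [graphInput]) rfl hF h5 h14 h15 h4 h4' h3
  refine (Runs.loop (T := roundTime n)
    (Inv := fun s => ∃ D ≤ m, ∃ i v, Valid G M D i v s)
    -- A lexicographic measure: one more color outweighs any loss of the label sum, which is at most
    -- `n * (n + 1)`.
    (μ := fun s => (m - s 5 0 0) * (n * (n + 1) + 2) + (n * (n + 1) - labelSum s))
    ?_ ⟨1, by omega, 0, 0, hs⟩).mono ?_ ?_
  · rintro s ⟨D, hD, i, v, h⟩ ht
    simp only [Expr.val, h.size, h.count] at ht
    refine (h.runs_round hE hM hf (by omega)).mono ?_ ?_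
    · have : D ≤ 2 * n + 1 := by omega
      unfold roundTime
      gcongr
    · rintro s' (⟨⟨i', v', h'⟩, hlt⟩ | ⟨hlt, h'⟩)
      · refine ⟨⟨D, hD, i', v', h'⟩, ?_⟩
        have := h'.labelSum_le
        rw [h.colors, h'.colors]
        omega
      · refine ⟨⟨D + 1, hlt, 0, 0, h'⟩, ?_⟩
        rw [h.colors, h'.colors, show m - D = m - (D + 1) + 1 by omega, Nat.add_mul]
        omega
  · gcongr
    · omega
    · omega
  · rintro s' ⟨⟨D, hD, i, v, h⟩, ht⟩
    simp only [Expr.val, h.size, h.count] at ht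
    obtain rfl : i = n := le_antisymm h.count_le (by omega)
    obtain rfl := h.eq_of_eq rfl
    exact ⟨D, hD, h⟩

/-- For `i = v = n` every element is colored. Colors from `D` on stay unused, and their empty
classes are independent. -/
theorem Valid.exists_coloring {D k : ℕ} {s : Store} (h : Valid G M D n n s) (hD : D ≤ k) :
    ∃ c : Fin n → Fin k, Outputs s c ∧ IsColoring (graphSystem G ∩ matroidSystem M) c := by
  have hcol : ∀ v : Fin n, s 2 0 v < D ∧ v ∈ row n s (s 2 0 v) := by
    intro v
    obtain ⟨c, hc, hv⟩ := (h.colored v).2 ⟨v.2.le, v.2.ne⟩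
    have hcv : s 2 0 v = c := h.labelled.col_eq c hc v hv
    rw [hcv]
    exact ⟨hc, hv⟩
  refine ⟨fun v => ⟨s 2 0 v, (hcol v).1.trans_le hD⟩, fun v => rfl, fun i => ?_⟩
  by_cases hi : (i : ℕ) < D
  · have hsub : {v : Fin n | (⟨s 2 0 v, (hcol v).1.trans_le hD⟩ : Fin k) = i} ⊆ row n s i := by
      rintro v rfl
      exact (hcol v).2
    exact ⟨(h.labelled.graph_indep i hi).mono hsub, (h.labelled.indep i hi).subset hsub⟩
  · have hempty : {v : Fin n | (⟨s 2 0 v, (hcol v).1.trans_le hD⟩ : Fin k) = i} = ∅ := by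
      ext v
      have := (hcol v).1
      simp [Fin.ext_iff]
      omega
    rw [hempty]
    exact ⟨Set.pairwise_empty _, M.empty_indep⟩

end Verification

theorem theorem2p6 :
    ∃ (P : Prog) (p : Polynomial ℕ),
      ∀ (n Δ : ℕ) (G : SimpleGraph (Fin n)) [DecidableRel G.Adj] (M : Matroid (Fin n)),
        G.maxDegree ≤ Δ → M.E = Set.univ → M.Loopless →
        ∃ (s : Store) (t : ℕ)
          (c : Fin n → Fin (Δ + chromaticNum (matroidSystem M) + 1)),
          Exec (indepOracle M) P (graphInput G) s t ∧
          t ≤ p.eval n ∧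
          Outputs s c ∧
          IsColoring (graphSystem G ∩ matroidSystem M) c := by
  let X : Polynomial ℕ := Polynomial.X
  -- The polynomial repeats the bound of `runs_coloring` term by term, with `roundTime` unfolded.
  refine ⟨.coloring, 8 * X + 20 + (((2 * X + 1) * (X * (X + 1) + 2) + X * (X + 1)) *
    (1 + ((2 * X + 1) * (X * 5 + 3 + ((X + 1) * (X + 11 + 2) + 2 + 1) + 2) + 2) +
    (7 + (X * (1 + ((2 * X + 1 + 1) * (1 + 2) + 2) + 2) + 2 + 4) + 1) + 1) + 1), ?_⟩
  intro n Δ G _ M hΔ hE hM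
  obtain ⟨f, hf⟩ := exists_isColoring_chromaticNum hE hM
  obtain ⟨s, t, hexec, ht, D, hD, hs⟩ :=
    runs_coloring (G := G) hE hM hf (chromaticNum_le hE hM)
  obtain ⟨c, hout, hc⟩ := hs.exists_coloring
    (k := Δ + chromaticNum (matroidSystem M) + 1) (by omega)
  refine ⟨s, t, c, hexec, ht.trans_eq ?_, hout, hc⟩
  simp [X, roundTime]
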